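/- Let $(X_n)_{n\in I}$ be a countable (finite or countably infinite) family of Polish spaces with their Borel $\sigma$-algebras, and let $X=\prod_{n} X_n$ carry the product topology. For each $n$ let $\mathcal P_n$ be a non-empty, convex set of Borel probability measures on $X_n$ that is compact for the weak topology (convergence of integrals of bounded continuous functions). Let $\mathcal P$ be the set of all Borel probability measures $\mu$ on $X$ whose $n$-th marginal distribution $\mu_n$ belongs to $\mathcal P_n$ for every $n$. For bounded Borel functions $g_n:X_n\to\mathbb R_+$ write $(\oplus g)(x)=\sum_n g_n(x_n)\in[0,+\infty]$ and $\phi_n(g_n)=\sup_{\nu\in\mathcal P_n}\int g_n\,d\nu$. For a bounded function $f:X\to\mathbb R$ put $$\phi(f)=\inf\Big\{m+\sum_n\phi_n(g_n)\;:\; m\in\mathbb R,\ g_n:X_n\to\mathbb R_+ \text{ bounded Borel for every } n,\ m+(\oplus g)(x)\ge f(x)\text{ for all }x\in X\Big\}.$$ Then, for every bounded upper semicontinuous function $f:X\to\mathbb R$, $$\phi(f)=\max_{\mu\in\mathcal P}\int f\,d\mu ,$$ and in particular $\phi(f)$ is finite and the maximum is attained. -/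

import Mathlib

open MeasureTheory
open scoped NNReal ENNReal

noncomputable section

namespace SublinearTransport

/-- A set `P` of Borel probability measures on `Y` is convex and weakly compact, and non-empty.
The topology on `ProbabilityMeasure Y` is that of convergence against bounded continuous functions;
convexity is that of the set of the same measures inside the cone of finite measures. -/
structure IsMarginalConstraint {Y : Type*} [TopologicalSpace Y] [MeasurableSpace Y]
    [OpensMeasurableSpace Y] (P : Set (ProbabilityMeasure Y)) : Prop where
  nonempty : P.Nonempty
  convex : Convex ℝ≥0 (ProbabilityMeasure.toFiniteMeasure '' P)
  isCompact : IsCompact P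

/-- `g` is a bounded Borel measurable function with values in the non-negative reals. -/
def IsBoundedBorel {Y : Type*} [MeasurableSpace Y] (g : Y → ℝ≥0) : Prop :=
  Measurable g ∧ ∃ C : ℝ≥0, ∀ y, g y ≤ C

/-- The sublinear functional `g ↦ sup_{ν ∈ P} ∫ g dν`. -/
def supIntegral {Y : Type*} [MeasurableSpace Y] (P : Set (ProbabilityMeasure Y))
    (g : Y → ℝ≥0) : ℝ≥0∞ :=
  ⨆ ν ∈ P, ∫⁻ y, (g y : ℝ≥0∞) ∂(ν : Measure Y)

/-- The function `⊕g : x ↦ ∑ n, g n (x n)`, with values in `[0, ∞]`. -/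
def oplus {ι : Type*} {X : ι → Type*} (g : ∀ n, X n → ℝ≥0) (x : ∀ n, X n) : ℝ≥0∞ :=
  ∑' n, (g n (x n) : ℝ≥0∞)

/-- The pairs `(m, g)`, with `m` real and each `g n` non-negative, bounded and Borel measurable,
such that `m + ⊕g ≥ f` everywhere. -/
def superhedges {ι : Type*} {X : ι → Type*} [∀ n, MeasurableSpace (X n)]
    (f : (∀ n, X n) → ℝ) : Set (ℝ × (∀ n, X n → ℝ≥0)) :=
  {p | (∀ n, IsBoundedBorel (p.2 n)) ∧
    ∀ x, (f x : EReal) ≤ (p.1 : EReal) + (oplus p.2 x : EReal)}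

/-- `φ(f) = inf {m + ∑ n, sup_{ν ∈ P n} ∫ g n dν : m + ⊕g ≥ f}`, as an extended real number. -/
def superhedgingValue {ι : Type*} {X : ι → Type*} [∀ n, MeasurableSpace (X n)]
    (P : ∀ n, Set (ProbabilityMeasure (X n))) (f : (∀ n, X n) → ℝ) : EReal :=
  ⨅ p ∈ superhedges f, (p.1 : EReal) + ((∑' n, supIntegral (P n) (p.2 n) : ℝ≥0∞) : EReal)

/-- The probability measures on the product whose `n`-th marginal belongs to `P n` for all `n`. -/
def couplings {ι : Type*} {X : ι → Type*} [∀ n, MeasurableSpace (X n)]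
    (P : ∀ n, Set (ProbabilityMeasure (X n))) : Set (ProbabilityMeasure (∀ n, X n)) :=
  {μ | ∀ n, μ.map (f := fun x : ∀ n, X n => x n) (measurable_pi_apply n).aemeasurable ∈ P n}

end SublinearTransport

end

/-! Weak duality integrates a superhedge against a coupling. For the converse, each Polish `X n` is
embedded in one compact metrizable space `H`, the Hilbert cube. There `f` is dominated by continuous
`F k` on `ι → H` decreasing to it along the embedding. Pairs (probability on `ι → H`, family of `ν n
∈ P n`) form a compact convex set, and "the marginals are the images of the `ν n`" is a family of
linear equations on it. If no pair satisfied these equations with `∫ F k ≥ φ(f)` for all `k`,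
Hahn–Banach would give finitely many test functions, hence a superhedge cheaper than `φ(f)`
(`exists_le_add_sum_sub_integral`). The measure so obtained has marginals carried by the images of
the `X n`, so it pulls back to a coupling, and `k → ∞` finishes. -/

namespace SublinearTransport

/-! ### Minimax by separation in finite dimension -/

/-- A minimax principle: if a compact set is convex with respect to the test functions `G` and
`T e`, and the constraints `T e = 0` can be met in the Lagrangian sense, then they can be met. -/
theorem exists_le_and_eq_zero_of_convexlike {Z E : Type*} [TopologicalSpace Z] [AddCommGroup E]
    [Module ℝ E] {K : Set Z} (hK : IsCompact K) {G : Z → ℝ} (hG : Continuous G)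
    (T : E →ₗ[ℝ] (Z → ℝ)) (hT : ∀ e, Continuous (T e))
    (hconv : ∀ z₁ ∈ K, ∀ z₂ ∈ K, ∀ a b : ℝ, 0 ≤ a → 0 ≤ b → a + b = 1 →
      ∃ z ∈ K, G z = a * G z₁ + b * G z₂ ∧ ∀ e, T e z = a * T e z₁ + b * T e z₂)
    (c : ℝ) (h : ∀ e, ∃ z ∈ K, c ≤ G z + T e z) (s : Finset E) :
    ∃ z ∈ K, c ≤ G z ∧ ∀ e ∈ s, T e z = 0 := by
  classical
  by_contra! hcon
  let φ : Z → ℝ × (s → ℝ) := fun z => (G z, fun e => T e z)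
  have hφ : Continuous φ := by fun_prop
  have hconvex : Convex ℝ (φ '' K) := by
    rintro _ ⟨z₁, h₁, rfl⟩ _ ⟨z₂, h₂, rfl⟩ a b ha hb hab
    obtain ⟨z, hz, hGz, hTz⟩ := hconv z₁ h₁ z₂ h₂ a b ha hb hab
    refine ⟨z, hz, Prod.ext (by simpa [φ] using hGz) ?_⟩
    funext e
    simpa [φ] using hTz e
  have hdisj : Disjoint (φ '' K) (Set.Ici c ×ˢ {(0 : s → ℝ)}) := by
    rw [Set.disjoint_left]
    rintro _ ⟨z, hz, rfl⟩ ⟨h₁, h₂⟩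
    obtain ⟨e, he, hne⟩ := hcon z hz h₁
    exact hne (congrFun h₂ ⟨e, he⟩)
  obtain ⟨l, u, v, hu, huv, hv⟩ := geometric_hahn_banach_compact_closed hconvex
    (hK.image hφ) ((convex_Ici c).prod (convex_singleton 0)) (isClosed_Ici.prod isClosed_singleton)
    hdisj
  set α := l (1, 0) with hα
  -- Linearity of `T` gathers the remaining coefficients of `l` into one element of `E`.
  set e : E := ∑ i : s, l (0, Pi.single i 1) • (i : E) with he
  have hl : ∀ z, l (φ z) = α * G z + T e z := by
    intro z
    have h₁ : φ z = G z • ((1 : ℝ), (0 : s → ℝ)) +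
        ∑ i : s, T i z • ((0 : ℝ), (Pi.single i 1 : s → ℝ)) := by
      refine Prod.ext ?_ ?_
      · simp [φ, Prod.fst_sum]
      · funext j
        simp [φ, Prod.snd_sum, Finset.sum_apply, Pi.single_apply]
    rw [h₁, map_add, map_smul, map_sum, he, map_sum, Finset.sum_apply, smul_eq_mul, mul_comm]
    congr 1
    refine Finset.sum_congr rfl fun i _ => ?_
    rw [map_smul, map_smul, Pi.smul_apply, smul_eq_mul, smul_eq_mul, mul_comm]
  have hlt : ∀ t, c ≤ t → v < t * α := by
    intro t ht
    have := hv (t, 0) ⟨ht, rfl⟩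
    rwa [show ((t, 0) : ℝ × (s → ℝ)) = t • ((1 : ℝ), (0 : s → ℝ)) by simp, map_smul,
      smul_eq_mul] at this
  have hα0 : 0 ≤ α := by
    by_contra! hneg
    have h₁ := hlt (max c (v / α)) (le_max_left _ _)
    have h₂ : max c (v / α) * α ≤ v / α * α :=
      mul_le_mul_of_nonpos_right (le_max_right _ _) hneg.le
    rw [div_mul_cancel₀ _ hneg.ne] at h₂
    linarith
  have hK' : ∀ z ∈ K, α * G z + T e z < u := fun z hz => hl z ▸ hu _ ⟨z, hz, rfl⟩
  -- If `α = 0`, then `T e < u < 0` on `K`, and a large multiple of `e` outweighs the bound `M` on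
  -- `G`. If `α > 0`, dividing by `α` suffices.
  rcases hα0.eq_or_lt with h0 | hpos
  · have hu0 : u < 0 := by
      have := hlt c le_rfl
      rw [← h0, mul_zero] at this
      linarith
    obtain ⟨M, hM⟩ := (hK.image hG).bddAbove
    have hM' : ∀ z ∈ K, G z ≤ M := fun z hz => hM ⟨z, hz, rfl⟩
    let r := (|M| + |c| + 1) / (-u)
    have hr : 0 ≤ r := div_nonneg (by positivity) (by linarith)
    have hru : r * u = -(|M| + |c| + 1) := by
      simp only [r]
      rw [div_mul_eq_mul_div, div_eq_iff (by linarith)]; ring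
    obtain ⟨z, hz, hle⟩ := h (r • e)
    rw [map_smul, Pi.smul_apply, smul_eq_mul] at hle
    have h₁ : r * T e z ≤ r * u := mul_le_mul_of_nonneg_left
      (by have := hK' z hz; rw [← h0] at this; linarith) hr
    have := hM' z hz
    have := le_abs_self M
    have := neg_abs_le c
    linarith
  · obtain ⟨z, hz, hle⟩ := h (α⁻¹ • e)
    rw [map_smul, Pi.smul_apply, smul_eq_mul] at hle
    have h₁ := mul_le_mul_of_nonneg_left hle hpos.le
    rw [mul_add, mul_inv_cancel_left₀ hpos.ne'] at h₁
    have := hK' z hz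
    have := hlt c le_rfl
    linarith

/-- Finite intersection property: as `G` decreases, finitely many bounds reduce to the one of
largest index. -/
theorem exists_forall_le_and_eq_zero_of_convexlike {Z E : Type*} [TopologicalSpace Z]
    [AddCommGroup E] [Module ℝ E] {K : Set Z} (hK : IsCompact K) {G : ℕ → Z → ℝ}
    (hG : ∀ k, Continuous (G k)) (hGa : Antitone G)
    (T : E →ₗ[ℝ] (Z → ℝ)) (hT : ∀ e, Continuous (T e))
    (hconv : ∀ z₁ ∈ K, ∀ z₂ ∈ K, ∀ a b : ℝ, 0 ≤ a → 0 ≤ b → a + b = 1 →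
      ∃ z ∈ K, (∀ k, G k z = a * G k z₁ + b * G k z₂) ∧ ∀ e, T e z = a * T e z₁ + b * T e z₂)
    (c : ℝ) (h : ∀ k e, ∃ z ∈ K, c ≤ G k z + T e z) :
    ∃ z ∈ K, (∀ k, c ≤ G k z) ∧ ∀ e, T e z = 0 := by
  classical
  obtain ⟨z, hz, hz'⟩ := hK.inter_iInter_nonempty
    (fun i : ℕ × E => {z | c ≤ G i.1 z} ∩ {z | T i.2 z = 0})
    (fun i => (isClosed_le continuous_const (hG _)).inter (isClosed_eq (hT _) continuous_const))
    (fun s => by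
      obtain ⟨z, hz, hc, h0⟩ := exists_le_and_eq_zero_of_convexlike hK (hG (s.sup Prod.fst)) T hT
        (fun z₁ h₁ z₂ h₂ a b ha hb hab => by
          obtain ⟨z, hz, hGz, hTz⟩ := hconv z₁ h₁ z₂ h₂ a b ha hb hab
          exact ⟨z, hz, hGz _, hTz⟩) c (h _) (s.image Prod.snd)
      refine ⟨z, hz, Set.mem_iInter₂.2 fun i hi => ⟨?_, h0 _ (Finset.mem_image_of_mem _ hi)⟩⟩
      exact hc.trans (hGa (Finset.le_sup (f := Prod.fst) hi) z))
  rw [Set.mem_iInter] at hz'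
  exact ⟨z, hz, fun k => (hz' (k, 0)).1, fun e => (hz' (0, e)).2⟩

/-! ### Continuous approximation from above -/

/-- A bounded upper semicontinuous function is, along an embedding into a metrizable space, the
limit of a decreasing sequence of continuous functions on the ambient space. -/
theorem exists_antitone_continuousMap_tendsto {X Y : Type*} [TopologicalSpace X] [Nonempty X]
    [TopologicalSpace Y] [TopologicalSpace.MetrizableSpace Y] {e : X → Y}
    (he : Topology.IsInducing e) {f : X → ℝ} (hf : UpperSemicontinuous f) {C : ℝ}
    (hC : ∀ x, |f x| ≤ C) :
    ∃ F : ℕ → C(Y, ℝ), Antitone F ∧ (∀ k x, f x ≤ F k (e x)) ∧ (∀ k y, F k y ≤ C) ∧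
      ∀ x, Filter.Tendsto (fun k => F k (e x)) Filter.atTop (nhds (f x)) := by
  let _ := TopologicalSpace.metrizableSpaceMetric Y
  -- Sup-convolution: `F k` is `k`-Lipschitz on all of `Y`.
  let F : ℕ → Y → ℝ := fun k y => ⨆ x, (f x - k * dist (e x) y)
  have hbound : ∀ (k : ℕ) y x, f x - k * dist (e x) y ≤ C := fun k y x => by
    have h₁ := (abs_le.1 (hC x)).2
    have : 0 ≤ k * dist (e x) y := by positivity
    linarith
  have hbdd : ∀ (k : ℕ) y, BddAbove (Set.range fun x => f x - k * dist (e x) y) := fun k y =>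
    ⟨C, by rintro _ ⟨x, rfl⟩; exact hbound k y x⟩
  have hFC : ∀ k y, F k y ≤ C := fun k y => ciSup_le (hbound k y)
  have hfF : ∀ k x, f x ≤ F k (e x) := fun k x => by
    simpa using le_ciSup (hbdd k (e x)) x
  have hcont : ∀ k, Continuous (F k) := fun k => by
    refine (LipschitzWith.of_le_add_mul (k : ℝ≥0) fun y y' => ciSup_le fun x => ?_).continuous
    have h₁ := le_ciSup (hbdd k y') x
    have h₂ := dist_triangle_right (e x) y' y
    have h₃ : (k : ℝ) * dist (e x) y' ≤ k * (dist (e x) y + dist y' y) :=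
      mul_le_mul_of_nonneg_left h₂ (Nat.cast_nonneg k)
    rw [dist_comm y' y] at h₃
    simp only [NNReal.coe_natCast]
    linarith
  refine ⟨fun k => ⟨F k, hcont k⟩, ?_, hfF, hFC, fun x => ?_⟩
  · intro k k' hk y
    refine ciSup_mono (hbdd k y) fun x => ?_
    have : (k : ℝ) * dist (e x) y ≤ k' * dist (e x) y := by gcongr
    linarith
  · rw [Metric.tendsto_atTop]
    intro ε hε
    have h₁ : ∀ᶠ x' in nhds x, f x' < f x + ε / 2 := hf x _ (by linarith)
    rw [he.nhds_eq_comap, Filter.eventually_comap] at h₁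
    obtain ⟨δ, hδ, hball⟩ := Metric.eventually_nhds_iff.1 h₁
    -- Beyond distance `δ` the penalty exceeds `2 * C`, the largest possible oscillation of `f`.
    obtain ⟨N, hN⟩ := exists_nat_gt (2 * C / δ)
    refine ⟨N, fun k hk => ?_⟩
    have hle : F k (e x) ≤ f x + ε / 2 := by
      refine ciSup_le fun x' => ?_
      rcases lt_or_ge (dist (e x') (e x)) δ with hd | hd
      · have h₂ := hball hd x' rfl
        have : 0 ≤ k * dist (e x') (e x) := by positivity
        linarith
      · have h₂ : (N : ℝ) * δ ≤ k * dist (e x') (e x) := by gcongr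
        have h₃ := (div_lt_iff₀ hδ).1 hN
        have := (abs_le.1 (hC x')).2
        have := (abs_le.1 (hC x)).1
        linarith
    rw [Real.dist_eq, ContinuousMap.coe_mk, abs_of_nonneg (by linarith [hfF k x])]
    linarith

/-! ### Weak duality and finiteness of the value -/

theorem measurable_oplus {ι : Type*} [Countable ι] {X : ι → Type*} [∀ n, MeasurableSpace (X n)]
    {g : ∀ n, X n → ℝ≥0} (hg : ∀ n, Measurable (g n)) : Measurable (oplus g) :=
  Measurable.tsum fun n => ((hg n).comp (measurable_pi_apply n)).coe_nnreal_ennreal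

theorem lintegral_oplus_le {ι : Type*} [Countable ι] {X : ι → Type*}
    [∀ n, MeasurableSpace (X n)] {P : ∀ n, Set (ProbabilityMeasure (X n))}
    {μ : ProbabilityMeasure (∀ n, X n)} (hμ : μ ∈ couplings P) {g : ∀ n, X n → ℝ≥0}
    (hg : ∀ n, Measurable (g n)) :
    ∫⁻ x, oplus g x ∂(μ : Measure (∀ n, X n)) ≤ ∑' n, supIntegral (P n) (g n) := by
  unfold oplus
  have hm : ∀ n, AEMeasurable (fun x : ∀ n, X n => (g n (x n) : ℝ≥0∞))
      (μ : Measure (∀ n, X n)) := fun n =>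
    ((hg n).comp (measurable_pi_apply n)).coe_nnreal_ennreal.aemeasurable
  rw [lintegral_tsum hm]
  refine ENNReal.tsum_le_tsum fun n => ?_
  have h := le_iSup₂ (f := fun (ν : ProbabilityMeasure (X n)) (_ : ν ∈ P n) =>
    ∫⁻ y, (g n y : ℝ≥0∞) ∂(ν : Measure (X n))) _ (hμ n)
  rwa [ProbabilityMeasure.toMeasure_map, lintegral_map (hg n).coe_nnreal_ennreal
    (measurable_pi_apply n)] at h

/-- Weak duality. -/
theorem integral_le_superhedgingValue {ι : Type*} [Countable ι] {X : ι → Type*}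
    [∀ n, MeasurableSpace (X n)] {P : ∀ n, Set (ProbabilityMeasure (X n))}
    {μ : ProbabilityMeasure (∀ n, X n)} (hμ : μ ∈ couplings P) {f : (∀ n, X n) → ℝ}
    (hf : Integrable f (μ : Measure (∀ n, X n))) :
    ((∫ x, f x ∂(μ : Measure (∀ n, X n)) : ℝ) : EReal) ≤ superhedgingValue P f := by
  refine le_iInf₂ fun p hp => ?_
  have hm := measurable_oplus fun n => (hp.1 n).1
  have hle := lintegral_oplus_le hμ fun n => (hp.1 n).1
  rcases eq_or_ne (∑' n, supIntegral (P n) (p.2 n)) ∞ with htop | htop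
  · simp [htop]
  have hfin := (hle.trans_lt htop.lt_top).ne
  have hint := integrable_toReal_of_lintegral_ne_top hm.aemeasurable hfin
  have hae := ae_lt_top hm hfin
  have h₁ : ∫ x, f x ∂(μ : Measure (∀ n, X n)) ≤
      p.1 + (∫⁻ x, oplus p.2 x ∂(μ : Measure (∀ n, X n))).toReal := by
    rw [← integral_toReal hm.aemeasurable hae]
    calc ∫ x, f x ∂(μ : Measure (∀ n, X n))
        ≤ ∫ x, (p.1 + (oplus p.2 x).toReal) ∂(μ : Measure (∀ n, X n)) := by
          refine integral_mono_ae hf ((integrable_const _).add hint) ?_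
          filter_upwards [hae] with x hx
          have := hp.2 x
          rw [← ENNReal.ofReal_toReal hx.ne, EReal.coe_ennreal_ofReal,
            max_eq_left ENNReal.toReal_nonneg] at this
          exact_mod_cast this
      _ = _ := by rw [integral_add (integrable_const _) hint]; simp
  have h₂ := ENNReal.toReal_mono htop hle
  rw [← ENNReal.ofReal_toReal htop, EReal.coe_ennreal_ofReal, max_eq_left ENNReal.toReal_nonneg]
  exact_mod_cast h₁.trans (by linarith)

theorem superhedgingValue_le {ι : Type*} {X : ι → Type*}
    [∀ n, MeasurableSpace (X n)] (P : ∀ n, Set (ProbabilityMeasure (X n)))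
    {f : (∀ n, X n) → ℝ} {C : ℝ} (hf : ∀ x, f x ≤ C) : superhedgingValue P f ≤ C := by
  refine (iInf₂_le (C, fun _ _ => 0) ?_).trans ?_
  · exact ⟨fun n => ⟨measurable_const, 0, fun _ => le_rfl⟩, fun x => by simpa [oplus] using hf x⟩
  · simp [supIntegral]

theorem couplings_nonempty {ι : Type*} {X : ι → Type*}
    [∀ n, MeasurableSpace (X n)] {P : ∀ n, Set (ProbabilityMeasure (X n))}
    (hP : ∀ n, (P n).Nonempty) : (couplings P).Nonempty := by
  choose ν hν using hP
  refine ⟨⟨Measure.infinitePi fun n => (ν n : Measure (X n)), inferInstance⟩, fun n => ?_⟩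
  convert hν n
  exact Subtype.ext (Measure.infinitePi_map_eval (fun n => (ν n : Measure (X n))) n)

/-! ### Test functions, convex combinations and superhedges -/

theorem integrable_comp_continuousMap {Y H : Type*} [TopologicalSpace Y] [MeasurableSpace Y]
    [OpensMeasurableSpace Y] [TopologicalSpace H] [CompactSpace H] (g : C(H, ℝ)) {φ : Y → H}
    (hφ : Continuous φ) (μ : Measure Y) [IsFiniteMeasure μ] :
    Integrable (fun y => g (φ y)) μ :=
  .of_bound (g.continuous.comp hφ).measurable.aestronglyMeasurable ‖g‖
    (.of_forall fun y => g.norm_coe_le_norm (φ y))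

theorem continuous_integral_comp_continuousMap {Y H : Type*} [TopologicalSpace Y]
    [MeasurableSpace Y] [OpensMeasurableSpace Y] [TopologicalSpace H] [CompactSpace H]
    (g : C(H, ℝ)) {φ : Y → H} (hφ : Continuous φ) :
    Continuous fun μ : ProbabilityMeasure Y => ∫ y, g (φ y) ∂(μ : Measure Y) :=
  ProbabilityMeasure.continuous_integral_boundedContinuousFunction
    ((BoundedContinuousFunction.mkOfCompact g).compContinuous ⟨φ, hφ⟩)

theorem exists_probabilityMeasure_convexCombination {Y : Type*} [MeasurableSpace Y]
    (μ₁ μ₂ : ProbabilityMeasure Y) {a b : ℝ≥0} (hab : a + b = 1) :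
    ∃ μ : ProbabilityMeasure Y, (μ : Measure Y) = a • (μ₁ : Measure Y) + b • (μ₂ : Measure Y) := by
  refine ⟨⟨a • (μ₁ : Measure Y) + b • (μ₂ : Measure Y), ⟨?_⟩⟩, rfl⟩
  simp only [Measure.add_apply, Measure.smul_apply, measure_univ, ENNReal.smul_def, smul_eq_mul,
    mul_one]
  exact_mod_cast hab

theorem IsMarginalConstraint.exists_convexCombination {Y : Type*} [TopologicalSpace Y]
    [MeasurableSpace Y] [OpensMeasurableSpace Y] {P : Set (ProbabilityMeasure Y)}
    (hP : IsMarginalConstraint P) {ν₁ ν₂ : ProbabilityMeasure Y} (h₁ : ν₁ ∈ P) (h₂ : ν₂ ∈ P)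
    {a b : ℝ≥0} (hab : a + b = 1) :
    ∃ ν ∈ P, (ν : Measure Y) = a • (ν₁ : Measure Y) + b • (ν₂ : Measure Y) := by
  obtain ⟨ν, hν, h⟩ := hP.convex ⟨ν₁, h₁, rfl⟩ ⟨ν₂, h₂, rfl⟩ zero_le zero_le hab
  exact ⟨ν, hν, congrArg Subtype.val h⟩

theorem integral_convexCombination {Y : Type*} [MeasurableSpace Y] {μ μ₁ μ₂ : Measure Y}
    {a b : ℝ≥0} (h : μ = a • μ₁ + b • μ₂) {g : Y → ℝ} (h₁ : Integrable g μ₁)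
    (h₂ : Integrable g μ₂) : ∫ y, g y ∂μ = a * ∫ y, g y ∂μ₁ + b * ∫ y, g y ∂μ₂ := by
  rw [h, integral_add_measure h₁.smul_measure_nnreal h₂.smul_measure_nnreal,
    integral_smul_nnreal_measure, integral_smul_nnreal_measure]
  rfl

/-- Finitely many continuous test functions cannot separate: otherwise they would provide a
superhedge whose cost is less than the superhedging value. -/
theorem exists_le_add_sum_sub_integral {ι : Type*} {X : ι → Type*}
    [∀ n, TopologicalSpace (X n)] [∀ n, MeasurableSpace (X n)] [∀ n, BorelSpace (X n)]
    {H : Type*} [TopologicalSpace H] [CompactSpace H] [Nonempty H]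
    {P : ∀ n, Set (ProbabilityMeasure (X n))}
    (hP : ∀ n, IsMarginalConstraint (P n)) (j : ∀ n, C(X n, H))
    {f : (∀ n, X n) → ℝ} {c : ℝ} (hc : (c : EReal) ≤ superhedgingValue P f)
    (F : C(ι → H, ℝ)) (hF : ∀ x, f x ≤ F fun n => j n (x n)) (e : ι →₀ C(H, ℝ)) :
    ∃ (y : ι → H) (ν : ∀ n, ProbabilityMeasure (X n)), (∀ n, ν n ∈ P n) ∧
      c ≤ F y + ∑ n ∈ e.support, (e n (y n) - ∫ x, e n (j n x) ∂(ν n : Measure (X n))) := by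
  classical
  have hmin := fun n => (hP n).isCompact.exists_isMinOn (hP n).nonempty
    (continuous_integral_comp_continuousMap (e n) (j n).continuous).continuousOn
  choose ν hν hνmin using hmin
  let Ψ : (ι → H) → ℝ := fun y =>
    F y + ∑ n ∈ e.support, (e n (y n) - ∫ x, e n (j n x) ∂(ν n : Measure (X n)))
  have hΨ : Continuous Ψ := by fun_prop
  obtain ⟨y, -, hy⟩ := isCompact_univ.exists_isMaxOn Set.univ_nonempty hΨ.continuousOn
  refine ⟨y, ν, hν, ?_⟩
  by_contra! hlt
  change Ψ y < c at hlt
  have habs : ∀ n z, 0 ≤ ‖e n‖ - e n z := fun n z =>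
    sub_nonneg.2 ((le_abs_self _).trans ((e n).norm_coe_le_norm z))
  -- Hedges must be non-negative, hence the shift by `‖e n‖`; `m` undoes it, so that the total cost
  -- is at most `Ψ y`. The minimality of `ν n` bounds the cost of `g n`.
  let g : ∀ n, X n → ℝ≥0 := fun n x => (‖e n‖ - e n (j n x)).toNNReal
  have hg0 : ∀ n ∉ e.support, g n = 0 := fun n hn => by
    funext x
    simp [g, Finsupp.notMem_support_iff.1 hn]
  let m : ℝ := Ψ y + ∑ n ∈ e.support, (∫ x, e n (j n x) ∂(ν n : Measure (X n)) - ‖e n‖)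
  have hmem : (m, g) ∈ superhedges f := by
    refine ⟨fun n => ⟨?_, (2 * ‖e n‖).toNNReal, fun x => ?_⟩, fun x => ?_⟩
    · exact (continuous_real_toNNReal.comp (continuous_const.sub
        ((e n).continuous.comp (j n).continuous))).measurable
    · refine Real.toNNReal_le_toNNReal ?_
      have := (abs_le.1 ((e n).norm_coe_le_norm (j n x))).1
      linarith
    · have h₁ : oplus g x = ENNReal.ofReal (∑ n ∈ e.support, (‖e n‖ - e n (j n (x n)))) := by
        rw [oplus, tsum_eq_sum (s := e.support) fun n hn => by simp [hg0 n hn],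
          ENNReal.ofReal_sum_of_nonneg fun n _ => habs n _]
        rfl
      have h₂ : Ψ (fun n => j n (x n)) ≤ Ψ y := hy (Set.mem_univ _)
      change (f x : EReal) ≤ (m : EReal) + (oplus g x : EReal)
      rw [h₁, EReal.coe_ennreal_ofReal, max_eq_left (Finset.sum_nonneg fun n _ => habs n _)]
      norm_cast
      have := hF x
      simp only [Ψ, m, Finset.sum_sub_distrib] at h₂ ⊢
      linarith
  have hcost : ∀ n, supIntegral (P n) (g n) ≤
      ENNReal.ofReal (‖e n‖ - ∫ x, e n (j n x) ∂(ν n : Measure (X n))) := fun n => by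
    refine iSup₂_le fun ν' hν' => ?_
    have hint := integrable_comp_continuousMap (e n) (j n).continuous (ν' : Measure (X n))
    have h₁ : ∫⁻ x, (g n x : ℝ≥0∞) ∂(ν' : Measure (X n)) =
        ENNReal.ofReal (∫ x, (‖e n‖ - e n (j n x)) ∂(ν' : Measure (X n))) :=
      (ofReal_integral_eq_lintegral_ofReal ((integrable_const _).sub hint)
        (.of_forall fun x => habs n _)).symm
    rw [h₁, integral_sub (integrable_const _) hint]
    refine ENNReal.ofReal_le_ofReal ?_
    have : ∫ x, e n (j n x) ∂(ν n : Measure (X n)) ≤ ∫ x, e n (j n x) ∂(ν' : Measure (X n)) :=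
      hνmin n hν'
    simp only [integral_const, probReal_univ, one_smul]
    linarith
  have hνle : ∀ n, 0 ≤ ‖e n‖ - ∫ x, e n (j n x) ∂(ν n : Measure (X n)) := fun n => by
    have hint := integrable_comp_continuousMap (e n) (j n).continuous (ν n : Measure (X n))
    have : 0 ≤ ∫ x, (‖e n‖ - e n (j n x)) ∂(ν n : Measure (X n)) :=
      integral_nonneg fun x => habs n (j n x)
    rw [integral_sub (integrable_const _) hint] at this
    simpa using this
  have hsum : ∑' n, supIntegral (P n) (g n) ≤
      ENNReal.ofReal (∑ n ∈ e.support, (‖e n‖ - ∫ x, e n (j n x) ∂(ν n : Measure (X n)))) := by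
    rw [tsum_eq_sum (s := e.support) fun n hn => by simp [hg0 n hn, supIntegral],
      ENNReal.ofReal_sum_of_nonneg fun n _ => hνle n]
    exact Finset.sum_le_sum fun n _ => hcost n
  have hval : superhedgingValue P f ≤ (Ψ y : EReal) := by
    refine (iInf₂_le _ hmem).trans ((add_le_add le_rfl
      (EReal.coe_ennreal_le_coe_ennreal_iff.2 hsum)).trans ?_)
    rw [EReal.coe_ennreal_ofReal, max_eq_left (Finset.sum_nonneg fun n _ => hνle n)]
    norm_cast
    simp only [m, Finset.sum_sub_distrib]
    linarith
  exact absurd (hc.trans hval) (not_le.2 (by exact_mod_cast hlt))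

/-! ### Duality in the compact product -/

section Duality

variable {ι : Type*} [Countable ι] {X : ι → Type*} [∀ n, TopologicalSpace (X n)]
  [∀ n, MeasurableSpace (X n)] [∀ n, BorelSpace (X n)]
  {H : Type*} [TopologicalSpace H] [CompactSpace H] [SecondCountableTopology H]
  [MeasurableSpace H] [BorelSpace H]

/-- The pairing of finitely many test functions with the difference between the marginals of a
measure on `ι → H` and the images of given measures on the spaces `X n`. -/
noncomputable def marginalDefect (j : ∀ n, C(X n, H)) : (ι →₀ C(H, ℝ)) →ₗ[ℝ]
    (ProbabilityMeasure (ι → H) × (∀ n, ProbabilityMeasure (X n)) → ℝ) :=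
  Finsupp.lsum ℝ fun n =>
    { toFun := fun g z => ∫ y, g (y n) ∂(z.1 : Measure (ι → H)) -
        ∫ x, g (j n x) ∂(z.2 n : Measure (X n))
      map_add' := fun g g' => by
        funext z
        simp only [ContinuousMap.add_apply, Pi.add_apply]
        rw [integral_add (integrable_comp_continuousMap g (continuous_apply n) _)
          (integrable_comp_continuousMap g' (continuous_apply n) _),
          integral_add (integrable_comp_continuousMap g (j n).continuous _)
          (integrable_comp_continuousMap g' (j n).continuous _)]
        ring
      map_smul' := fun r g => by
        funext z
        simp only [ContinuousMap.smul_apply, Pi.smul_apply, smul_eq_mul, integral_const_mul,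
          RingHom.id_apply]
        ring }

theorem marginalDefect_apply (j : ∀ n, C(X n, H)) (e : ι →₀ C(H, ℝ))
    (z : ProbabilityMeasure (ι → H) × (∀ n, ProbabilityMeasure (X n))) :
    marginalDefect j e z = ∑ n ∈ e.support, (∫ y, e n (y n) ∂(z.1 : Measure (ι → H)) -
      ∫ x, e n (j n x) ∂(z.2 n : Measure (X n))) := by
  simp [marginalDefect, Finsupp.lsum_apply, Finsupp.sum, Finset.sum_apply]

theorem marginalDefect_single (j : ∀ n, C(X n, H)) (n : ι) (g : C(H, ℝ))
    (z : ProbabilityMeasure (ι → H) × (∀ n, ProbabilityMeasure (X n))) :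
    marginalDefect j (Finsupp.single n g) z = ∫ y, g (y n) ∂(z.1 : Measure (ι → H)) -
      ∫ x, g (j n x) ∂(z.2 n : Measure (X n)) := by
  rw [marginalDefect, Finsupp.lsum_single]
  rfl

theorem continuous_marginalDefect (j : ∀ n, C(X n, H)) (e : ι →₀ C(H, ℝ)) :
    Continuous (marginalDefect j e) := by
  rw [funext (marginalDefect_apply j e)]
  refine continuous_finsetSum _ fun n _ => ?_
  exact ((continuous_integral_comp_continuousMap (e n) (continuous_apply n)).comp
    continuous_fst).sub ((continuous_integral_comp_continuousMap (e n) (j n).continuous).comp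
      ((continuous_apply n).comp continuous_snd))

/-- Duality in the compact space `ι → H`, for a decreasing sequence of continuous functions. -/
theorem exists_marginals_eq_and_le_integral [T2Space H] [Nonempty H]
    {P : ∀ n, Set (ProbabilityMeasure (X n))}
    (hP : ∀ n, IsMarginalConstraint (P n)) (j : ∀ n, C(X n, H))
    {f : (∀ n, X n) → ℝ} {c : ℝ} (hc : (c : EReal) ≤ superhedgingValue P f)
    {F : ℕ → C(ι → H, ℝ)} (hFa : Antitone F) (hF : ∀ k x, f x ≤ F k fun n => j n (x n)) :
    ∃ (μ : ProbabilityMeasure (ι → H)) (ν : ∀ n, ProbabilityMeasure (X n)),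
      (∀ n, ν n ∈ P n) ∧
      (∀ n, (μ : Measure (ι → H)).map (fun y => y n) = (ν n : Measure (X n)).map (j n)) ∧
      ∀ k, c ≤ ∫ y, F k y ∂(μ : Measure (ι → H)) := by
  obtain ⟨⟨μ, ν⟩, hz, hcz, hTz⟩ := exists_forall_le_and_eq_zero_of_convexlike
    (K := Set.univ ×ˢ Set.pi Set.univ P)
    (G := fun k (z : ProbabilityMeasure (ι → H) × (∀ n, ProbabilityMeasure (X n))) =>
      ∫ y, F k y ∂(z.1 : Measure (ι → H)))
    (isCompact_univ.prod (isCompact_univ_pi fun n => (hP n).isCompact))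
    (fun k => (continuous_integral_comp_continuousMap (F k) continuous_id).comp continuous_fst)
    (fun k k' hk z => integral_mono (integrable_comp_continuousMap (F k') continuous_id _)
      (integrable_comp_continuousMap (F k) continuous_id _) (hFa hk))
    (marginalDefect j) (continuous_marginalDefect j)
    (fun z₁ h₁ z₂ h₂ a b ha hb hab => by
      lift a to ℝ≥0 using ha
      lift b to ℝ≥0 using hb
      have hab' : a + b = 1 := by exact_mod_cast hab
      obtain ⟨μ, hμ⟩ := exists_probabilityMeasure_convexCombination z₁.1 z₂.1 hab'
      have hex := fun n => (hP n).exists_convexCombination (h₁.2 n trivial) (h₂.2 n trivial) hab'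
      choose ν hν hν' using hex
      refine ⟨(μ, ν), ⟨trivial, fun n _ => hν n⟩, fun k => ?_, fun e => ?_⟩
      · exact integral_convexCombination hμ
          (integrable_comp_continuousMap (F k) continuous_id _)
          (integrable_comp_continuousMap (F k) continuous_id _)
      · simp only [marginalDefect_apply, Finset.mul_sum, ← Finset.sum_add_distrib]
        refine Finset.sum_congr rfl fun n _ => ?_
        rw [integral_convexCombination hμ
          (integrable_comp_continuousMap (e n) (continuous_apply n) _)
          (integrable_comp_continuousMap (e n) (continuous_apply n) _),
          integral_convexCombination (hν' n)
          (integrable_comp_continuousMap (e n) (j n).continuous _)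
          (integrable_comp_continuousMap (e n) (j n).continuous _)]
        ring) c
    (fun k e => by
      obtain ⟨y, ν, hν, hle⟩ := exists_le_add_sum_sub_integral hP j hc (F k) (hF k) e
      -- A Dirac mass turns the pointwise maximum into an integral.
      refine ⟨(⟨Measure.dirac y, inferInstance⟩, ν), ⟨trivial, fun n _ => hν n⟩, ?_⟩
      simpa [marginalDefect_apply] using hle)
  refine ⟨μ, ν, fun n => hz.2 n trivial, fun n => ?_, hcz⟩
  have := Measure.isProbabilityMeasure_map (μ := (μ : Measure (ι → H)))
    (measurable_pi_apply n).aemeasurable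
  have := Measure.isProbabilityMeasure_map (μ := (ν n : Measure (X n)))
    (j n).continuous.measurable.aemeasurable
  have : TopologicalSpace.MetrizableSpace H := inferInstance
  refine ext_of_forall_integral_eq_of_IsFiniteMeasure fun g => ?_
  rw [integral_map (measurable_pi_apply n).aemeasurable
      g.continuous.measurable.aestronglyMeasurable,
    integral_map (j n).continuous.measurable.aemeasurable
      g.continuous.measurable.aestronglyMeasurable]
  have h := hTz (Finsupp.single n g.toContinuousMap)
  rw [marginalDefect_single, sub_eq_zero] at h
  exact h

end Duality

/-! ### Return to the original product -/

/-- A measure on a product whose marginals are carried by the images of measurable embeddings is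
the image of a measure on the product of the sources. -/
theorem exists_map_eq_of_marginals {ι : Type*} [Countable ι] {X : ι → Type*}
    [∀ n, MeasurableSpace (X n)] {H : Type*} [MeasurableSpace H] {j : ∀ n, X n → H}
    (hj : ∀ n, MeasurableEmbedding (j n))
    (hJ : MeasurableEmbedding fun (x : ∀ n, X n) n => j n (x n))
    (μ : ProbabilityMeasure (ι → H)) (ν : ∀ n, ProbabilityMeasure (X n))
    (h : ∀ n, (μ : Measure (ι → H)).map (fun y => y n) = (ν n : Measure (X n)).map (j n)) :
    ∃ ρ : ProbabilityMeasure (∀ n, X n),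
      (ρ : Measure (∀ n, X n)).map (fun x n => j n (x n)) = (μ : Measure (ι → H)) ∧
      ∀ n, ρ.map (f := fun x : ∀ n, X n => x n) (measurable_pi_apply n).aemeasurable = ν n := by
  have hae : ∀ᵐ y ∂(μ : Measure (ι → H)), y ∈ Set.range fun (x : ∀ n, X n) n => j n (x n) := by
    have h₁ : ∀ n, ∀ᵐ y ∂(μ : Measure (ι → H)), y n ∈ Set.range (j n) := fun n => by
      refine ae_of_ae_map (f := fun y : ι → H => y n)
        (measurable_pi_apply n).aemeasurable (p := fun z : H => z ∈ Set.range (j n)) ?_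
      rw [h n, (hj n).ae_map_iff]
      exact .of_forall fun x => ⟨x, rfl⟩
    -- Countability of `ι` is what allows the null sets to be united.
    filter_upwards [ae_all_iff.2 h₁] with y hy
    choose x hx using hy
    exact ⟨x, funext hx⟩
  have hmap : ((μ : Measure (ι → H)).comap fun (x : ∀ n, X n) n => j n (x n)).map
      (fun x n => j n (x n)) = (μ : Measure (ι → H)) := by
    rw [hJ.map_comap, Measure.restrict_eq_self_of_ae_mem hae]
  have hprob : IsProbabilityMeasure
      ((μ : Measure (ι → H)).comap fun (x : ∀ n, X n) n => j n (x n)) := by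
    refine ⟨?_⟩
    rw [← Set.preimage_univ (f := fun (x : ∀ n, X n) n => j n (x n)), ← hJ.map_apply, hmap,
      measure_univ]
  refine ⟨⟨_, hprob⟩, hmap, fun n => Subtype.ext ((hj n).map_injective ?_)⟩
  refine Eq.trans ?_ (h n)
  have h₁ := Measure.map_map (μ := (μ : Measure (ι → H)).comap fun (x : ∀ n, X n) n => j n (x n))
    (hj n).measurable (measurable_pi_apply n)
  have h₂ := Measure.map_map (μ := (μ : Measure (ι → H)).comap fun (x : ∀ n, X n) n => j n (x n))
    (measurable_pi_apply n) hJ.measurable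
  rw [hmap] at h₂
  exact h₁.trans h₂.symm

end SublinearTransport

theorem mainTheorem6 {ι : Type*} [Countable ι] {X : ι → Type*}
    [∀ n, TopologicalSpace (X n)] [∀ n, PolishSpace (X n)]
    [∀ n, MeasurableSpace (X n)] [∀ n, BorelSpace (X n)]
    (P : ∀ n, Set (ProbabilityMeasure (X n)))
    (hP : ∀ n, SublinearTransport.IsMarginalConstraint (P n))
    (f : (∀ n, X n) → ℝ) (hf : UpperSemicontinuous f) (hb : ∃ C : ℝ, ∀ x, |f x| ≤ C) :
    IsGreatest
      ((fun μ : ProbabilityMeasure (∀ n, X n) =>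
        ((∫ x, f x ∂(μ : Measure (∀ n, X n)) : ℝ) : EReal)) '' SublinearTransport.couplings P)
      (SublinearTransport.superhedgingValue P f) := by
  obtain ⟨C, hC⟩ := hb
  have hint : ∀ μ : ProbabilityMeasure (∀ n, X n), Integrable f (μ : Measure (∀ n, X n)) :=
    fun μ => .of_bound hf.measurable.aestronglyMeasurable C (.of_forall hC)
  have hweak : ∀ μ ∈ SublinearTransport.couplings P,
      ((∫ x, f x ∂(μ : Measure (∀ n, X n)) : ℝ) : EReal) ≤
        SublinearTransport.superhedgingValue P f :=
    fun μ hμ => SublinearTransport.integral_le_superhedgingValue hμ (hint μ)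
  refine ⟨?_, by rintro _ ⟨μ, hμ, rfl⟩; exact hweak μ hμ⟩
  obtain ⟨μ₀, hμ₀⟩ := SublinearTransport.couplings_nonempty fun n => (hP n).nonempty
  have hbot : SublinearTransport.superhedgingValue P f ≠ ⊥ :=
    ((EReal.bot_lt_coe _).trans_le (hweak μ₀ hμ₀)).ne'
  have htop : SublinearTransport.superhedgingValue P f ≠ ⊤ :=
    ((SublinearTransport.superhedgingValue_le P fun x => (abs_le.1 (hC x)).2).trans_lt
      (EReal.coe_lt_top _)).ne
  have hcoe := EReal.coe_toReal htop hbot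
  set c := (SublinearTransport.superhedgingValue P f).toReal
  have : Nonempty (∀ n, X n) := (μ₀ : Measure (∀ n, X n)).nonempty_of_neZero
  have hemb : ∀ n, ∃ j : X n → ℕ → unitInterval, Topology.IsEmbedding j := fun n =>
    let _ := TopologicalSpace.metrizableSpaceMetric (X n)
    Metric.PiNatEmbed.exists_embedding_to_hilbert_cube
  choose j hj using hemb
  have hJ : Topology.IsEmbedding fun (x : ∀ n, X n) n => j n (x n) := .piMap hj
  obtain ⟨F, hFa, hfF, hFC, hFt⟩ :=
    SublinearTransport.exists_antitone_continuousMap_tendsto hJ.isInducing hf hC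
  obtain ⟨μ, ν, hν, hmarg, hle⟩ := SublinearTransport.exists_marginals_eq_and_le_integral hP
    (fun n => ⟨j n, (hj n).continuous⟩) hcoe.le hFa hfF
  -- Lusin–Souslin: the image is Borel, though it need not be closed.
  have hJm := hJ.continuous.measurableEmbedding hJ.injective
  obtain ⟨ρ, hρ, hρν⟩ := SublinearTransport.exists_map_eq_of_marginals
    (fun n => (hj n).continuous.measurableEmbedding (hj n).injective) hJm μ ν hmarg
  have hmem : ρ ∈ SublinearTransport.couplings P := fun n => by
    rw [hρν n]
    exact hν n
  have hlim : c ≤ ∫ x, f x ∂(ρ : Measure (∀ n, X n)) := by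
    refine ge_of_tendsto' (tendsto_integral_of_dominated_convergence
      (F := fun k (x : ∀ n, X n) => F k fun n => j n (x n)) (fun _ => C)
      (fun k => ((F k).continuous.comp hJ.continuous).measurable.aestronglyMeasurable)
      (integrable_const C) (fun k => .of_forall fun x => ?_) (.of_forall hFt)) fun k => ?_
    · exact abs_le.2 ⟨(abs_le.1 (hC x)).1.trans (hfF k x), hFC k _⟩
    · refine (hle k).trans_eq ?_
      rw [← hρ, hJm.integral_map]
  exact ⟨ρ, hmem, le_antisymm (hweak ρ hmem) (hcoe.ge.trans (EReal.coe_le_coe_iff.2 hlim))⟩
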